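/- Let $3\le p\le n$ be integers, $C\in\mathbb R^{n\times n}$, $r^1,r^2\in\mathbb R^n$, and consider the discrete optimal transport problem: minimize $\sum_{i,j}C_{ij}\gamma_{ij}$ over $\gamma\in\mathbb R^{n\times n}$ with $\gamma\ge 0$, $\sum_j\gamma_{ij}=r^1_i$ for all $i$ and $\sum_i\gamma_{ij}=r^2_j$ for all $j$. With $x=\mathrm{vec}(\gamma)$, $c=\mathrm{vec}(C)$, $N=n^2$, $\mathcal N=\{1,\dots,N\}$, write it as $\min\{c^Tx : Ax=b,\ x\ge0\}$. For feasible $x$ and $\mathcal I\subseteq\mathcal N$ let $$q(x;\mathcal I)=\min\{c^Td : x+d\ge 0,\ Ad=0,\ d_i=0\ \text{for } i\in\mathcal N\setminus\mathcal I\},$$ and let $\mathcal D(x;\mathcal I)$ be the set of minimizers. Let $G\in\{0,1\}^{n\times n}$ be the matrix whose $j$-th column has ones exactly in the rows $j,j+1,\dots,j+p-1$ taken modulo $n$ (diagonal band of width $p$). Let $\{x^k\}$, $\{\mathcal I_k\}$ be generated by the diagonal-band random block coordinate descent method: $x^0$ is feasible; for $k=0,1,2,\dots$, the set $\mathcal I_k$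 is the support of $\mathrm{vec}(\bar D^k)$, where $\bar D^k$ arises from $G$ by a uniformly random permutation of the rows and of the columns, drawn independently of $x^0,\dots,x^k$; then $x^{k+1}=x^k+d^k$ for some $d^k\in\mathcal D(x^k;\mathcal I_k)$. For $v\in(0,1]$ say that the expected Gauss–Southwell-$q$ rule holds with constant $v$ if, for every $k\ge0$, $q(x^k;\mathcal I_k)$ is integrable and $$\mathbb E[q(x^k;\mathcal I_k)\mid x^0,\dots,x^k]\le v\,q(x^k;\mathcal N)\quad\text{almost surely.}$$ Then the expected Gauss–Southwell-$q$ rule holds with some $v \ge \frac{n(p-2)}{(n^2-3)(n!)^2}$; indeed it holds with constant $v_0=\frac{n(p-2)}{(n^2-3)(n!)^2}\in(0,1]$. Moreover, for every optimal solution $x^*$, $c^T(x^k-x^*)\to0$ almost surely; $c^T(x^k-x^*)$ is integrable with nonnegative expectation for every $k$; and for every $v\in(0,1]$ with which the rule holds (in particular $v=v_0$), $$\mathbb E[c^T(x^k-x^*)]\le(1-v)^k\,\mathbb E[c^T(x^0-x^*)]\qquad\text{for all }k\ge0.$$ -/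

import Mathlib

open MeasureTheory ProbabilityTheory Filter Topology Matrix

noncomputable section

namespace RBCD

section LinearProgram

variable {ι κ : Type*} [Fintype κ]

/-- The feasible set `{x | A x = b, x ≥ 0}` of the standard linear program. -/
def feasibleSet (A : Matrix ι κ ℝ) (b : ι → ℝ) : Set (κ → ℝ) :=
  {x | A *ᵥ x = b ∧ 0 ≤ x}

/-- The optimal solution set of `min cᵀ x` subject to `A x = b`, `x ≥ 0`. -/
def optimalSet (A : Matrix ι κ ℝ) (b : ι → ℝ) (c : κ → ℝ) : Set (κ → ℝ) :=
  {x | x ∈ feasibleSet A b ∧ ∀ y ∈ feasibleSet A b, c ⬝ᵥ x ≤ c ⬝ᵥ y}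

/-- Directions `d` with `x + d ≥ 0`, `A d = 0`, and `d i = 0` for all `i` outside the working
set `I`. -/
def directions (A : Matrix ι κ ℝ) (x : κ → ℝ) (I : Set κ) : Set (κ → ℝ) :=
  {d | 0 ≤ x + d ∧ A *ᵥ d = 0 ∧ ∀ i, i ∉ I → d i = 0}

/-- `𝒟(x; I)`: the minimizers of `cᵀ d` over the directions supported in `I`. -/
def argminDirections (A : Matrix ι κ ℝ) (c : κ → ℝ) (x : κ → ℝ) (I : Set κ) : Set (κ → ℝ) :=
  {d | d ∈ directions A x I ∧ ∀ d' ∈ directions A x I, c ⬝ᵥ d ≤ c ⬝ᵥ d'}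

/-- `q(x; I)`: the minimal value of `cᵀ d` over the directions supported in `I`. -/
def q (A : Matrix ι κ ℝ) (c : κ → ℝ) (x : κ → ℝ) (I : Set κ) : ℝ :=
  sInf ((fun d => c ⬝ᵥ d) '' directions A x I)

end LinearProgram

section ExpectedRule

variable {ι κ Ω : Type*} [Fintype κ] [MeasurableSpace Ω]

/-- The sigma-algebra generated by the iterates `x⁰, …, xᵏ`. -/
abbrev history (x : ℕ → Ω → κ → ℝ) (k : ℕ) : MeasurableSpace Ω :=
  ⨆ j : ℕ, ⨆ _ : j ≤ k, MeasurableSpace.comap (x j) inferInstance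

/-- The expected Gauss-Southwell-`q` rule with constant `v ∈ (0, 1]`: for every `k`,
`E[q(xᵏ; I_k) | x⁰, …, xᵏ] ≤ v q(xᵏ; all indices)` almost surely. Integrability is part of the rule,
so that the conditional expectation is a genuine one. -/
def ExpectedGaussSouthwellQ (μ : Measure Ω) (A : Matrix ι κ ℝ) (c : κ → ℝ)
    (x : ℕ → Ω → κ → ℝ) (I : ℕ → Ω → Set κ) (v : ℝ) : Prop :=
  0 < v ∧ v ≤ 1 ∧ ∀ k : ℕ,
    Integrable (fun ω => q A c (x k ω) (I k ω)) μ ∧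
    μ[fun ω => q A c (x k ω) (I k ω) | history x k]
      ≤ᵐ[μ] fun ω => v * q A c (x k ω) Set.univ

end ExpectedRule

section OptimalTransport

/-- The optimal transport constraint matrix. A plan `γ` is vectorized column by column as
`Matrix.vec γ`, where `Matrix.vec γ (j, i) = γ i j`. Row `Sum.inl i` of the constraint matrix gives
the row sum `∑ j, γ i j`, and row `Sum.inr j` gives the column sum `∑ i, γ i j`. -/
def otMatrix (n : ℕ) : Matrix (Fin n ⊕ Fin n) (Fin n × Fin n) ℝ :=
  Matrix.of fun s ji => Sum.elim (fun i => if ji.2 = i then 1 else 0)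
    (fun j => if ji.1 = j then 1 else 0) s

/-- The `0/1` matrix whose `j`-th column has ones exactly in the `p` cyclically consecutive rows
`j, j + 1, …, j + p - 1` (indices start at `0`; `3 ≤ p ≤ n`). -/
def bandMatrix (n p : ℕ) : Matrix (Fin n) (Fin n) ℝ :=
  Matrix.of fun i j =>
    if ((j : ℕ) ≤ i ∧ (i : ℕ) < j + p) ∨ (i : ℕ) + n < j + p then 1 else 0

/-- The law of the diagonal-band working set: the support of the band matrix after a uniformly
random permutation of its rows and a uniformly random permutation of its columns. -/
def diagonalBandLaw (n p : ℕ) : PMF (Set (Fin n × Fin n)) :=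
  (PMF.uniformOfFintype (Equiv.Perm (Fin n) × Equiv.Perm (Fin n))).map
    fun π => Function.support (Matrix.vec ((bandMatrix n p).submatrix π.1 π.2))

/-- A realization on `(Ω, μ)` of random block coordinate descent with diagonal-band working sets,
for the optimal transport problem with cost `C` and marginals `r₁`, `r₂`. -/
structure IsDiagonalBandRBCD {Ω : Type*} [MeasurableSpace Ω] (μ : Measure Ω) (n p : ℕ)
    (C : Matrix (Fin n) (Fin n) ℝ) (r₁ r₂ : Fin n → ℝ)
    (x : ℕ → Ω → Fin n × Fin n → ℝ) (I : ℕ → Ω → Set (Fin n × Fin n)) : Prop where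
  measurable_iterate : ∀ k, Measurable (x k)
  measurable_workingSet : ∀ k, Measurable (I k)
  /-- The starting point is feasible. -/
  init : ∀ ω, x 0 ω ∈ feasibleSet (otMatrix n) (Sum.elim r₁ r₂)
  /-- Step 1: the working set is drawn from the diagonal-band law ... -/
  law : ∀ k, μ.map (I k) = (diagonalBandLaw n p).toMeasure
  /-- ... independently of the iterates computed so far. -/
  indep : ∀ k, Indep (MeasurableSpace.comap (I k) inferInstance) (history x k) μ
  /-- Steps 2 and 3: `xᵏ⁺¹ = xᵏ + dᵏ` with `dᵏ ∈ 𝒟(xᵏ; I_k)`. -/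
  step : ∀ k ω, ∃ d ∈ argminDirections (otMatrix n) (Matrix.vec C) (x k ω) (I k ω),
    x (k + 1) ω = x k ω + d

end OptimalTransport

end RBCD

end

/-!
Let `d` be the difference of a feasible plan and `x`. It has vanishing row and column sums, so, when
it is nonzero, its support contains a cycle of the complete bipartite graph along which the signs
of `d` alternate (`exists_alternating_cycle`): follow from each column a positive entry and then
from its row a negative entry, until a column repeats. Subtracting a multiple of the circulation
along that cycle kills an entry of `d` without changing any sign
(`exists_conformal_tridiagonal`). As a nonzero balanced vector has at least four nonzero entries,
`d` is a sum of at most `n ^ 2 - 3` such circulations, each of them a direction at `x`; so one of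
them achieves the fraction `1 / (n ^ 2 - 3)` of the best decrease.

A cycle folds flat onto a tridiagonal pattern (`exists_cycle_subset_permutedTridiagonal`), and a
tridiagonal pattern, after permuting rows and columns, sits inside the cyclic band of width `p ≥ 3`
in at least `n * (p - 2)` ways: `n` simultaneous cyclic shifts and `p - 2` choices of three
consecutive diagonals (`mul_le_card_filter_subset_bandSupport`). Hence the average over the
`(n!) ^ 2` pairs of permutations of the best decrease on the permuted band is at least
`n * (p - 2) / ((n ^ 2 - 3) * (n!) ^ 2)` times the best decrease overall
(`average_q_bandSupport_le`). No other property of the working sets is needed, because `q` is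
nonpositive and antitone in the working set.

To pass from this average to the conditional expectation, `q(·; S)` is shown to be measurable for
each fixed `S`: the transport polytope is compact, so sublevel sets of `q(·; S)` are projections of
compact sets (`isClosed_setOf_q_le`). Independence of the working set from the history does the rest
(`condExp_apply_of_indep`). Since `q(x; all)` is at most `cᵀ (x* - x)`, the rule with constant `v`
contracts the expected gap by `1 - v` in each step. The gaps decrease pathwise and their
expectations tend to `0`, which gives almost sure convergence.
-/

namespace RBCD

/-! ### Restricted linear programs over a compact feasible set -/

section LinearProgram

variable {ι κ : Type*} [Fintype κ] {A : Matrix ι κ ℝ} {b : ι → ℝ} {c x d : κ → ℝ} {I J : Set κ}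

lemma directions_mono (h : I ⊆ J) : directions A x I ⊆ directions A x J :=
  fun _ hd => ⟨hd.1, hd.2.1, fun i hi => hd.2.2 i fun hI => hi (h hI)⟩

lemma zero_mem_directions (hx : x ∈ feasibleSet A b) : 0 ∈ directions A x I :=
  ⟨by simpa using hx.2, by simp, fun _ _ => rfl⟩

lemma add_mem_feasibleSet (hx : x ∈ feasibleSet A b) (hd : d ∈ directions A x I) :
    x + d ∈ feasibleSet A b :=
  ⟨by rw [mulVec_add, hx.1, hd.2.1, add_zero], hd.1⟩

lemma sub_mem_directions_univ {y : κ → ℝ} (hx : x ∈ feasibleSet A b)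
    (hy : y ∈ feasibleSet A b) : y - x ∈ directions A x Set.univ :=
  ⟨by simpa using hy.2, by rw [mulVec_sub, hx.1, hy.1, sub_self], fun i hi => (hi trivial).elim⟩

lemma continuous_dotProduct_left (c : κ → ℝ) : Continuous fun y : κ → ℝ => c ⬝ᵥ y :=
  continuous_const.dotProduct continuous_id

/-- The pairs of a feasible point and a direction supported in `I` of objective change at most
`a`. -/
def directionPairs (A : Matrix ι κ ℝ) (b : ι → ℝ) (c : κ → ℝ) (I : Set κ) (a : ℝ) :
    Set ((κ → ℝ) × (κ → ℝ)) :=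
  {z | z.1 ∈ feasibleSet A b ∧ z.2 ∈ directions A z.1 I ∧ c ⬝ᵥ z.2 ≤ a}

lemma isClosed_feasibleSet (A : Matrix ι κ ℝ) (b : ι → ℝ) : IsClosed (feasibleSet A b) :=
  (isClosed_eq (Continuous.matrix_mulVec continuous_const continuous_id)
    continuous_const).inter (isClosed_le continuous_const continuous_id)

lemma isCompact_directionPairs (hF : IsCompact (feasibleSet A b)) (c : κ → ℝ) (I : Set κ)
    (a : ℝ) : IsCompact (directionPairs A b c I a) := by
  -- both `z.1` and `z.1 + z.2` are feasible, so `z.2` is a difference of feasible points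
  refine (((hF.prod hF).image (f := fun z => (z.1, z.2 - z.1))
    (by fun_prop)).of_isClosed_subset ?_ ?_)
  · have h1 : IsClosed {z : (κ → ℝ) × (κ → ℝ) | z.1 ∈ feasibleSet A b} :=
      (isClosed_feasibleSet A b).preimage continuous_fst
    have h2 : IsClosed {z : (κ → ℝ) × (κ → ℝ) | 0 ≤ z.1 + z.2} :=
      isClosed_le continuous_const (by fun_prop)
    have h3 : IsClosed {z : (κ → ℝ) × (κ → ℝ) | A *ᵥ z.2 = 0} :=
      isClosed_eq (Continuous.matrix_mulVec continuous_const continuous_snd) continuous_const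
    have h4 : IsClosed {z : (κ → ℝ) × (κ → ℝ) | ∀ i, i ∉ I → z.2 i = 0} := by
      simp only [Set.ofPred_forall]
      exact isClosed_iInter fun i => isClosed_iInter fun _ =>
        isClosed_eq (by fun_prop) continuous_const
    have h5 : IsClosed {z : (κ → ℝ) × (κ → ℝ) | c ⬝ᵥ z.2 ≤ a} :=
      isClosed_le ((continuous_dotProduct_left c).comp continuous_snd) continuous_const
    exact h1.inter ((h2.inter (h3.inter h4)).inter h5)
  · rintro ⟨y, d⟩ ⟨hy, hd, -⟩
    exact ⟨(y, y + d), ⟨hy, add_mem_feasibleSet hy hd⟩, by simp⟩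

lemma exists_abs_dotProduct_le (hF : IsCompact (feasibleSet A b)) (c : κ → ℝ) :
    ∃ M, ∀ x ∈ feasibleSet A b, |c ⬝ᵥ x| ≤ M := by
  obtain ⟨M, hM⟩ := hF.exists_bound_of_continuousOn (continuous_dotProduct_left c).continuousOn
  exact ⟨M, hM⟩

lemma bddBelow_image_directions (hF : IsCompact (feasibleSet A b)) (c : κ → ℝ)
    (hx : x ∈ feasibleSet A b) (I : Set κ) :
    BddBelow ((fun d => c ⬝ᵥ d) '' directions A x I) := by
  obtain ⟨M, hM⟩ := exists_abs_dotProduct_le hF c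
  refine ⟨-M - c ⬝ᵥ x, ?_⟩
  rintro _ ⟨d, hd, rfl⟩
  have := (abs_le.1 (hM _ (add_mem_feasibleSet hx hd))).1
  rw [dotProduct_add] at this
  simp only
  linarith

lemma q_le (hF : IsCompact (feasibleSet A b)) (hx : x ∈ feasibleSet A b)
    (hd : d ∈ directions A x I) : q A c x I ≤ c ⬝ᵥ d :=
  csInf_le (bddBelow_image_directions hF c hx I) ⟨d, hd, rfl⟩

lemma le_q {a : ℝ} (hx : x ∈ feasibleSet A b) (h : ∀ d ∈ directions A x I, a ≤ c ⬝ᵥ d) :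
    a ≤ q A c x I := by
  refine le_csInf ⟨_, 0, zero_mem_directions hx, rfl⟩ ?_
  rintro _ ⟨d, hd, rfl⟩
  exact h d hd

lemma q_nonpos (hF : IsCompact (feasibleSet A b)) (hx : x ∈ feasibleSet A b) :
    q A c x I ≤ 0 := by
  simpa using q_le (c := c) (I := I) hF hx (zero_mem_directions hx)

lemma q_anti (hF : IsCompact (feasibleSet A b)) (hx : x ∈ feasibleSet A b) (h : I ⊆ J) :
    q A c x J ≤ q A c x I :=
  le_q hx fun _ hd => q_le hF hx (directions_mono h hd)

lemma q_eq_of_mem_argminDirections (hF : IsCompact (feasibleSet A b))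
    (hx : x ∈ feasibleSet A b) (hd : d ∈ argminDirections A c x I) : q A c x I = c ⬝ᵥ d :=
  le_antisymm (q_le hF hx hd.1) (le_q hx hd.2)

lemma exists_abs_q_le (hF : IsCompact (feasibleSet A b)) (c : κ → ℝ) :
    ∃ M, ∀ x ∈ feasibleSet A b, ∀ I, |q A c x I| ≤ M := by
  obtain ⟨M, hM⟩ := exists_abs_dotProduct_le hF c
  refine ⟨2 * M, fun x hx I => ?_⟩
  rw [abs_of_nonpos (q_nonpos hF hx), neg_le]
  refine le_q hx fun d hd => ?_
  have h1 := (abs_le.1 (hM _ (add_mem_feasibleSet hx hd))).1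
  have h2 := (abs_le.1 (hM _ hx)).2
  rw [dotProduct_add] at h1
  linarith

lemma exists_mem_directions_dotProduct_eq_q (hF : IsCompact (feasibleSet A b)) (c : κ → ℝ)
    (hx : x ∈ feasibleSet A b) (I : Set κ) : ∃ d ∈ directions A x I, c ⬝ᵥ d = q A c x I := by
  have hK : IsCompact (directions A x I) := by
    obtain ⟨M, hM⟩ := exists_abs_dotProduct_le hF c
    -- the bound `M - c ⬝ᵥ x` is met by every direction, so the direction set is a slice
    have h1 : directions A x I =
        Prod.snd '' (directionPairs A b c I (M - c ⬝ᵥ x) ∩ {z | z.1 = x}) := by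
      ext d
      constructor
      · intro hd
        refine ⟨(x, d), ⟨⟨hx, hd, ?_⟩, rfl⟩, rfl⟩
        have := (abs_le.1 (hM _ (add_mem_feasibleSet hx hd))).2
        rw [dotProduct_add] at this
        simp only
        linarith
      · rintro ⟨⟨y, d'⟩, ⟨⟨-, hd, -⟩, hy⟩, rfl⟩
        simp only [Set.mem_ofPred_eq] at hy
        subst hy
        exact hd
    rw [h1]
    exact ((isCompact_directionPairs hF c I _).inter_right
      (isClosed_eq continuous_fst continuous_const)).image continuous_snd
  obtain ⟨d, hd, hmin⟩ := hK.exists_isMinOn ⟨0, zero_mem_directions hx⟩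
    (continuous_dotProduct_left c).continuousOn
  exact ⟨d, hd, le_antisymm (le_q hx fun d' hd' => hmin hd') (q_le hF hx hd)⟩

/-- Lower semicontinuity of `q(·; I)` on the feasible set: the sublevel sets are projections of
compact sets. -/
lemma isClosed_setOf_q_le (hF : IsCompact (feasibleSet A b)) (c : κ → ℝ) (I : Set κ) (a : ℝ) :
    IsClosed {x | x ∈ feasibleSet A b ∧ q A c x I ≤ a} := by
  have : {x | x ∈ feasibleSet A b ∧ q A c x I ≤ a} = Prod.fst '' directionPairs A b c I a := by
    ext x
    constructor
    · rintro ⟨hx, hq⟩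
      obtain ⟨d, hd, hdq⟩ := exists_mem_directions_dotProduct_eq_q hF c hx I
      exact ⟨(x, d), ⟨hx, hd, hdq.trans_le hq⟩, rfl⟩
    · rintro ⟨⟨y, d⟩, ⟨hy, hd, ha⟩, rfl⟩
      exact ⟨hy, (q_le hF hy hd).trans ha⟩
  rw [this]
  exact ((isCompact_directionPairs hF c I a).image continuous_fst).isClosed

lemma measurable_q_comp {Ω : Type*} {m : MeasurableSpace Ω} {X : Ω → κ → ℝ}
    (hF : IsCompact (feasibleSet A b)) (c : κ → ℝ) (hX : Measurable X)
    (hXF : ∀ ω, X ω ∈ feasibleSet A b) (I : Set κ) : Measurable fun ω => q A c (X ω) I := by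
  refine measurable_of_Iic fun a => ?_
  have : (fun ω => q A c (X ω) I) ⁻¹' Set.Iic a =
      X ⁻¹' {x | x ∈ feasibleSet A b ∧ q A c x I ≤ a} := by
    ext ω
    simp [hXF ω]
  rw [this]
  exact hX (isClosed_setOf_q_le hF c I a).measurableSet

end LinearProgram

/-! ### Alternating cycles in balanced sign patterns -/

lemma exists_mem_periodicPts_of_forall_imp {α : Type*} [Finite α] {f : α → α} {P : α → Prop}
    {a : α} (ha : P a) (hf : ∀ b, P b → P (f b)) : ∃ b, P b ∧ b ∈ Function.periodicPts f := by
  have hP : ∀ k, P (f^[k] a) := fun k => by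
    induction k with
    | zero => exact ha
    | succ k ih => rw [Function.iterate_succ_apply']; exact hf _ ih
  obtain ⟨i, j, hij, h⟩ := Finite.exists_ne_map_eq_of_infinite fun k : ℕ => f^[k] a
  wlog hlt : i < j generalizing i j
  · exact this j i hij.symm h.symm (by omega)
  refine ⟨f^[i] a, hP i, Function.mk_mem_periodicPts (n := j - i) (by omega) ?_⟩
  change f^[j - i] (f^[i] a) = f^[i] a
  rw [← Function.iterate_add_apply, Nat.sub_add_cancel hlt.le]
  exact h.symm

lemma exists_perm_apply_eq {α : Type*} {l : ℕ} {a b : Fin l → α} (ha : Function.Injective a)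
    (hb : Function.Injective b) : ∃ σ : Equiv.Perm α, ∀ k, σ (a k) = b k := by
  obtain ⟨σ, hσ⟩ := (Equiv.Perm.isMultiplyPretransitive α l).exists_smul_eq ⟨a, ha⟩ ⟨b, hb⟩
  exact ⟨σ, fun k => DFunLike.congr_fun hσ k⟩

/-- The entries `(j, i)` (column, row) that become tridiagonal once row `i` is moved to position
`σ i` and column `j` to position `τ j`. -/
def permutedTridiagonal {n : ℕ} (σ τ : Equiv.Perm (Fin n)) : Set (Fin n × Fin n) :=
  {ji | (σ ji.2 : ℕ) ≤ τ ji.1 + 1 ∧ (τ ji.1 : ℕ) ≤ σ ji.2 + 1}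

/-- A `2l`-cycle alternating between the columns `c k` and the rows `r k` folds flat onto the
tridiagonal pattern: the vertex numbered `t < 2 * l` along the cycle goes to position
`min t (2 * l - 1 - t)`, which is shared by one row and one column. -/
lemma exists_cycle_subset_permutedTridiagonal {n l : ℕ} {c r : ℕ → Fin n}
    (hc : Set.InjOn c (Set.Iio l)) (hr : Set.InjOn r (Set.Iio l)) (hl : c l = c 0) :
    ∃ σ τ : Equiv.Perm (Fin n), ∀ k < l,
      (c k, r k) ∈ permutedTridiagonal σ τ ∧ (c (k + 1), r k) ∈ permutedTridiagonal σ τ := by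
  have hci : Function.Injective fun k : Fin l => c k :=
    fun a b h => Fin.ext (hc a.2 b.2 h)
  have hri : Function.Injective fun k : Fin l => r k :=
    fun a b h => Fin.ext (hr a.2 b.2 h)
  have hln : l ≤ n := by simpa using Fintype.card_le_of_injective _ hci
  obtain ⟨σ, hσ⟩ := exists_perm_apply_eq hri
    (b := fun k : Fin l => (⟨min (2 * k + 1) (2 * l - 2 - 2 * k), by omega⟩ : Fin n))
    (fun a b h => by simp only [Fin.mk.injEq] at h; omega)
  obtain ⟨τ, hτ⟩ := exists_perm_apply_eq hci
    (b := fun k : Fin l => (⟨min (2 * k) (2 * l - 1 - 2 * k), by omega⟩ : Fin n))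
    (fun a b h => by simp only [Fin.mk.injEq] at h; omega)
  refine ⟨σ, τ, fun k hk => ?_⟩
  have h1 : (σ (r k) : ℕ) = min (2 * k + 1) (2 * l - 2 - 2 * k) :=
    congrArg Fin.val (hσ ⟨k, hk⟩)
  have h2 : ∀ m < l, (τ (c m) : ℕ) = min (2 * m) (2 * l - 1 - 2 * m) := fun m hm =>
    congrArg Fin.val (hτ ⟨m, hm⟩)
  have h3 := h2 k hk
  have h4 : (τ (c (k + 1)) : ℕ) ≤ min (2 * k + 1) (2 * l - 2 - 2 * k) + 1 ∧
      min (2 * k + 1) (2 * l - 2 - 2 * k) ≤ (τ (c (k + 1)) : ℕ) + 1 := by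
    rcases Nat.lt_or_ge (k + 1) l with h | h
    · rw [h2 _ h]; omega
    · rw [show k + 1 = l by omega, hl, h2 0 (by omega)]; omega
  refine ⟨⟨?_, ?_⟩, ⟨?_, ?_⟩⟩ <;> simp only <;> omega

section Balanced

variable {n : ℕ} {d : Fin n × Fin n → ℝ}

lemma otMatrix_mulVec_inl (d : Fin n × Fin n → ℝ) (i : Fin n) :
    (otMatrix n *ᵥ d) (Sum.inl i) = ∑ j, d (j, i) := by
  simp [otMatrix, mulVec, dotProduct, Fintype.sum_prod_type]

lemma otMatrix_mulVec_inr (d : Fin n × Fin n → ℝ) (j : Fin n) :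
    (otMatrix n *ᵥ d) (Sum.inr j) = ∑ i, d (j, i) := by
  simp [otMatrix, mulVec, dotProduct, Fintype.sum_prod_type_right]

lemma otMatrix_mulVec_eq_zero_iff :
    otMatrix n *ᵥ d = 0 ↔ (∀ i, ∑ j, d (j, i) = 0) ∧ ∀ j, ∑ i, d (j, i) = 0 := by
  simp [funext_iff, Sum.forall, otMatrix_mulVec_inl, otMatrix_mulVec_inr]

/-- The support of a nonzero `d` with vanishing row and column sums contains a cycle
`c 0, r 0, c 1, r 1, …, c l = c 0` along which the signs of `d` alternate. -/
lemma exists_alternating_cycle (hd : otMatrix n *ᵥ d = 0) (hne : d ≠ 0) :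
    ∃ (l : ℕ) (c r : ℕ → Fin n), 2 ≤ l ∧ Set.InjOn c (Set.Iio l) ∧ Set.InjOn r (Set.Iio l) ∧
      c l = c 0 ∧ ∀ k, 0 < d (c k, r k) ∧ d (c (k + 1), r k) < 0 := by
  obtain ⟨hrow, hcol⟩ := otMatrix_mulVec_eq_zero_iff.1 hd
  have hpos : ∀ j, ∃ i, (∃ i, d (j, i) ≠ 0) → 0 < d (j, i) := fun j => by
    by_cases h : ∃ i, d (j, i) ≠ 0
    · obtain ⟨i, hi⟩ := h
      obtain ⟨i', -, hi'⟩ := Finset.exists_pos_of_sum_zero_of_exists_nonzero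
        (fun i => d (j, i)) (hcol j) ⟨i, Finset.mem_univ i, hi⟩
      exact ⟨i', fun _ => hi'⟩
    · obtain ⟨x, -⟩ := Function.ne_iff.1 hne
      exact ⟨x.1, fun h' => (h h').elim⟩
  have hneg : ∀ i, ∃ j, (∃ j, d (j, i) ≠ 0) → d (j, i) < 0 := fun i => by
    by_cases h : ∃ j, d (j, i) ≠ 0
    · obtain ⟨j, hj⟩ := h
      obtain ⟨j', -, hj'⟩ := Finset.exists_pos_of_sum_zero_of_exists_nonzero
        (s := Finset.univ) (fun j => -d (j, i)) (by simp [hrow i])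
        ⟨j, Finset.mem_univ j, by simpa using hj⟩
      exact ⟨j', fun _ => by simpa using hj'⟩
    · obtain ⟨x, -⟩ := Function.ne_iff.1 hne
      exact ⟨x.1, fun h' => (h h').elim⟩
  choose g hg using hpos
  choose h hh using hneg
  have hg' : ∀ j, (∃ i, d (j, i) ≠ 0) → d (h (g j), g j) < 0 := fun j hj =>
    hh (g j) ⟨j, (hg j hj).ne'⟩
  obtain ⟨⟨j₀, i₀⟩, h₀⟩ := Function.ne_iff.1 hne
  obtain ⟨j, hj, hper⟩ := exists_mem_periodicPts_of_forall_imp (f := fun j => h (g j))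
    (P := fun j => ∃ i, d (j, i) ≠ 0) ⟨i₀, h₀⟩ (fun j hj => ⟨g j, (hg' j hj).ne⟩)
  set f : Fin n → Fin n := fun j => h (g j)
  set l := Function.minimalPeriod f j
  have hl0 : 0 < l := Function.minimalPeriod_pos_of_mem_periodicPts hper
  have hP : ∀ k, ∃ i, d (f^[k] j, i) ≠ 0 := fun k => by
    induction k with
    | zero => exact hj
    | succ k ih => rw [Function.iterate_succ_apply']; exact ⟨_, (hg' _ ih).ne⟩
  have hl : f^[l] j = j := Function.iterate_minimalPeriod
  have hsgn : ∀ k, 0 < d (f^[k] j, g (f^[k] j)) ∧ d (f^[k + 1] j, g (f^[k] j)) < 0 :=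
    fun k => ⟨hg _ (hP k), by rw [Function.iterate_succ_apply']; exact hg' _ (hP k)⟩
  refine ⟨l, fun k => f^[k] j, fun k => g (f^[k] j), ?_,
    Function.iterate_injOn_Iio_minimalPeriod, ?_, hl, hsgn⟩
  · -- a fixed column would carry entries of both signs in the same place
    by_contra hlt
    have h1 : l = 1 := by omega
    have hfix : f^[0 + 1] j = j := by rw [zero_add, ← h1]; exact hl
    have h2 := hsgn 0
    rw [hfix] at h2
    exact lt_asymm h2.1 h2.2
  · -- equal rows have equal successor columns, and `f` is injective on the orbit
    intro a ha b hb hab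
    have key : ∀ a, f^[l - 1] (f (f^[a] j)) = f^[a] j := fun a => by
      rw [← Function.iterate_succ_apply, Nat.succ_eq_add_one, Nat.sub_add_cancel hl0,
        ← Function.iterate_add_apply, add_comm, Function.iterate_add_apply, hl]
    refine Function.iterate_injOn_Iio_minimalPeriod ha hb ?_
    have : f (f^[a] j) = f (f^[b] j) := congrArg h hab
    change f^[a] j = f^[b] j
    rw [← key a, ← key b, this]

end Balanced

/-! ### Conformal decomposition into tridiagonal directions -/

section Conformal

variable {n : ℕ} {d : Fin n × Fin n → ℝ}

/-- The circulation along the cycle `c 0, r 0, c 1, r 1, …` of half-length `l`: `1` on the entries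
`(c k, r k)` and `-1` on the entries `(c (k + 1), r k)`. -/
def cycleVector {n : ℕ} (l : ℕ) (c r : ℕ → Fin n) : Fin n × Fin n → ℝ := fun ji =>
  ∑ k ∈ Finset.range l,
    if r k = ji.2 then (if c k = ji.1 then 1 else 0) - (if c (k + 1) = ji.1 then 1 else 0) else 0

lemma otMatrix_mulVec_cycleVector {l : ℕ} {c r : ℕ → Fin n} (hl : c l = c 0) :
    otMatrix n *ᵥ cycleVector l c r = 0 := by
  refine otMatrix_mulVec_eq_zero_iff.2 ⟨fun i => ?_, fun j => ?_⟩
  · simp only [cycleVector]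
    rw [Finset.sum_comm]
    refine Finset.sum_eq_zero fun k _ => ?_
    split_ifs <;> simp
  · simp only [cycleVector]
    rw [Finset.sum_comm]
    simp only [Finset.sum_ite_eq, Finset.mem_univ, if_true]
    rw [Finset.sum_range_sub' (fun k => if c k = j then (1 : ℝ) else 0), hl, sub_self]

lemma cycleVector_apply {l : ℕ} {c r : ℕ → Fin n} (hr : Set.InjOn r (Set.Iio l)) {k : ℕ}
    (hk : k < l) (j : Fin n) : cycleVector l c r (j, r k) =
      (if c k = j then 1 else 0) - (if c (k + 1) = j then 1 else 0) := by
  rw [cycleVector, Finset.sum_eq_single_of_mem k (Finset.mem_range.2 hk), if_pos rfl]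
  intro m hm hmk
  rw [if_neg fun h => hmk (hr (Finset.mem_range.1 hm) hk h)]

lemma cycleVector_apply_eq_zero {l : ℕ} {c r : ℕ → Fin n} {ji : Fin n × Fin n}
    (h : ∀ k < l, r k ≠ ji.2) : cycleVector l c r ji = 0 :=
  Finset.sum_eq_zero fun k hk => if_neg (h k (Finset.mem_range.1 hk))

/-- Every nonzero balanced `d` admits a balanced vector `e` supported on a permuted tridiagonal
pattern, lying between `0` and `d` entrywise, and agreeing with `d` in some nonzero entry. The
support of `d`, containing a cycle, has at least four elements. -/
lemma exists_conformal_tridiagonal (hd : otMatrix n *ᵥ d = 0) (hne : d ≠ 0) :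
    ∃ e : Fin n × Fin n → ℝ, otMatrix n *ᵥ e = 0 ∧
      (∃ σ τ, ∀ ji, ji ∉ permutedTridiagonal σ τ → e ji = 0) ∧
      (∀ ji, (0 ≤ e ji ∧ e ji ≤ d ji) ∨ (d ji ≤ e ji ∧ e ji ≤ 0)) ∧
      (∃ ji, d ji ≠ 0 ∧ e ji = d ji) ∧ 4 ≤ (Finset.univ.filter fun ji => d ji ≠ 0).card := by
  obtain ⟨l, c, r, hl2, hc, hr, hl, hsgn⟩ := exists_alternating_cycle hd hne
  set e := cycleVector l c r with he
  have hcc : ∀ k, c k ≠ c (k + 1) := fun k h => by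
    have := hsgn k
    rw [← h] at this
    exact lt_asymm this.1 this.2
  have hval : ∀ ji, e ji = 0 ∨ ∃ k < l, (ji = (c k, r k) ∧ e ji = 1) ∨
      (ji = (c (k + 1), r k) ∧ e ji = -1) := by
    rintro ⟨j, i⟩
    by_cases h : ∃ k < l, r k = i
    · obtain ⟨k, hk, rfl⟩ := h
      have h1 := cycleVector_apply (c := c) hr hk j
      rw [← he] at h1
      by_cases h2 : c k = j
      · right
        refine ⟨k, hk, Or.inl ⟨by rw [h2], ?_⟩⟩
        rw [h1, if_pos h2, if_neg (h2 ▸ (hcc k).symm), sub_zero]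
      · by_cases h3 : c (k + 1) = j
        · right
          refine ⟨k, hk, Or.inr ⟨by rw [h3], ?_⟩⟩
          rw [h1, if_pos h3, if_neg h2, zero_sub]
        · left
          rw [h1, if_neg h2, if_neg h3, sub_zero]
    · push Not at h
      exact Or.inl (cycleVector_apply_eq_zero h)
  have hpn : ∀ ji, e ji = 0 ∨ (e ji = 1 ∧ 0 < d ji) ∨ (e ji = -1 ∧ d ji < 0) := fun ji => by
    rcases hval ji with h | ⟨k, -, ⟨rfl, h⟩ | ⟨rfl, h⟩⟩
    · exact Or.inl h
    · exact Or.inr (Or.inl ⟨h, (hsgn k).1⟩)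
    · exact Or.inr (Or.inr ⟨h, (hsgn k).2⟩)
  -- scale by the smallest absolute value of `d` along the cycle
  obtain ⟨m, hm, hmin⟩ := (Finset.univ.filter fun ji => e ji ≠ 0).exists_min_image
    (fun ji => |d ji|) ⟨(c 0, r 0), by
      rw [Finset.mem_filter, he, cycleVector_apply hr (by omega), if_pos rfl,
        if_neg (hcc 0).symm]
      simp⟩
  simp only [Finset.mem_filter, Finset.mem_univ, true_and] at hm hmin
  obtain ⟨σ, τ, hστ⟩ := exists_cycle_subset_permutedTridiagonal hc hr hl
  refine ⟨|d m| • e, by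
    rw [mulVec_smul, otMatrix_mulVec_cycleVector hl, smul_zero], ⟨σ, τ, ?_⟩, ?_,
    ⟨m, ?_⟩, ?_⟩
  · intro ji hji
    rcases hval ji with h | ⟨k, hk, ⟨rfl, -⟩ | ⟨rfl, -⟩⟩
    · simp [h]
    · exact (hji (hστ k hk).1).elim
    · exact (hji (hστ k hk).2).elim
  · intro ji
    simp only [Pi.smul_apply, smul_eq_mul]
    have h0 := abs_nonneg (d m)
    rcases hpn ji with h | ⟨h, hs⟩ | ⟨h, hs⟩
    · rw [h, mul_zero]
      rcases le_total 0 (d ji) with h' | h'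
      · exact Or.inl ⟨le_rfl, h'⟩
      · exact Or.inr ⟨h', le_rfl⟩
    · have := hmin ji (by rw [h]; norm_num)
      rw [abs_of_pos hs] at this
      rw [h, mul_one]
      exact Or.inl ⟨h0, this⟩
    · have := hmin ji (by rw [h]; norm_num)
      rw [abs_of_neg hs] at this
      rw [h]
      exact Or.inr ⟨by linarith, by linarith⟩
  · simp only [Pi.smul_apply, smul_eq_mul]
    rcases hpn m with h | ⟨h, hs⟩ | ⟨h, hs⟩
    · exact (hm h).elim
    · exact ⟨hs.ne', by rw [h, abs_of_pos hs, mul_one]⟩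
    · exact ⟨hs.ne, by rw [h, abs_of_neg hs]; ring⟩
  · have h01 : r 0 ≠ r 1 := fun h => by
      have := hr (show 0 < l by omega) (show 1 < l by omega) h
      omega
    have hc0 := hcc 0
    have hc1 := hcc 1
    have hcard : ({(c 0, r 0), (c 1, r 0), (c 1, r 1), (c 2, r 1)} :
        Finset (Fin n × Fin n)).card = 4 := by
      rw [Finset.card_insert_of_notMem, Finset.card_insert_of_notMem,
        Finset.card_insert_of_notMem, Finset.card_singleton] <;>
      simp_all
    rw [← hcard]
    refine Finset.card_le_card ?_
    intro ji hji
    simp only [Finset.mem_insert, Finset.mem_singleton] at hji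
    rw [Finset.mem_filter]
    refine ⟨Finset.mem_univ _, ?_⟩
    rcases hji with rfl | rfl | rfl | rfl
    · exact (hsgn 0).1.ne'
    · exact (hsgn 0).2.ne
    · exact (hsgn 1).1.ne'
    · exact (hsgn 1).2.ne

/-- Peeling off conformal tridiagonal directions one at a time. Each shrinks the support of `d`,
and a nonempty support has at least four elements, so at most `|supp d| - 3` of them are needed. -/
lemma mul_le_dotProduct_of_forall_tridiagonal {c x : Fin n × Fin n → ℝ} {m : ℝ} (hx : 0 ≤ x)
    (hm0 : m ≤ 0) (hm : ∀ σ τ, ∀ e ∈ directions (otMatrix n) x (permutedTridiagonal σ τ),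
      m ≤ c ⬝ᵥ e)
    (hd : otMatrix n *ᵥ d = 0) (hxd : 0 ≤ x + d) (hne : d ≠ 0) :
    (((Finset.univ.filter fun ji => d ji ≠ 0).card : ℝ) - 3) * m ≤ c ⬝ᵥ d := by
  induction hs : (Finset.univ.filter fun ji => d ji ≠ 0).card using Nat.strong_induction_on
    generalizing d with
  | _ s ih =>
  obtain ⟨e, hAe, ⟨σ, τ, hστ⟩, hconf, ⟨m₀, hm₀, hem₀⟩, h4⟩ := exists_conformal_tridiagonal hd hne
  have hxe : 0 ≤ x + e := fun ji => by
    have h1 := hx ji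
    have h2 := hxd ji
    simp only [Pi.zero_apply, Pi.add_apply] at h1 h2 ⊢
    rcases hconf ji with h | h <;> linarith
  have hxde : 0 ≤ x + (d - e) := fun ji => by
    have h1 := hx ji
    have h2 := hxd ji
    simp only [Pi.zero_apply, Pi.add_apply, Pi.sub_apply] at h1 h2 ⊢
    rcases hconf ji with h | h <;> linarith
  have hce := hm σ τ e ⟨hxe, hAe, hστ⟩
  have hAde : otMatrix n *ᵥ (d - e) = 0 := by rw [mulVec_sub, hd, hAe, sub_self]
  have hsplit : c ⬝ᵥ d = c ⬝ᵥ e + c ⬝ᵥ (d - e) := by rw [← dotProduct_add, add_sub_cancel]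
  rw [hs] at h4
  have h4' : (4 : ℝ) ≤ s := by exact_mod_cast h4
  by_cases hde : d - e = 0
  · rw [hsplit, hde, dotProduct_zero, add_zero]
    nlinarith
  · have hlt : (Finset.univ.filter fun ji => (d - e) ji ≠ 0).card < s := by
      rw [← hs]
      refine Finset.card_lt_card (Finset.ssubset_iff_of_subset ?_ |>.2 ⟨m₀, ?_, ?_⟩)
      · intro ji hji
        simp only [Finset.mem_filter, Finset.mem_univ, true_and, Pi.sub_apply] at hji ⊢
        intro h0
        apply hji
        rcases hconf ji with h | h <;> linarith
      · simpa using hm₀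
      · simp [hem₀]
    have h5 := ih _ hlt hAde hxde hde rfl
    have h6 : ((Finset.univ.filter fun ji => (d - e) ji ≠ 0).card : ℝ) + 1 ≤ s := by
      exact_mod_cast hlt
    rw [hsplit]
    nlinarith

/-- The best tridiagonal direction achieves at least the fraction `1 / (n ^ 2 - 3)` of the best
possible decrease. -/
lemma exists_permutedTridiagonal_q_le {b : Fin n ⊕ Fin n → ℝ} (hn : 2 ≤ n)
    (hF : IsCompact (feasibleSet (otMatrix n) b)) (c : Fin n × Fin n → ℝ)
    {x : Fin n × Fin n → ℝ} (hx : x ∈ feasibleSet (otMatrix n) b) :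
    ∃ σ τ, ((n : ℝ) ^ 2 - 3) * q (otMatrix n) c x (permutedTridiagonal σ τ)
      ≤ q (otMatrix n) c x Set.univ := by
  obtain ⟨⟨σ, τ⟩, hmin⟩ := Finite.exists_min
    fun z : Equiv.Perm (Fin n) × Equiv.Perm (Fin n) =>
      q (otMatrix n) c x (permutedTridiagonal z.1 z.2)
  refine ⟨σ, τ, le_q hx fun d hd => ?_⟩
  set m := q (otMatrix n) c x (permutedTridiagonal σ τ)
  have hm0 : m ≤ 0 := q_nonpos hF hx
  have hn' : (2 : ℝ) ≤ n := by exact_mod_cast hn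
  by_cases hne : d = 0
  · rw [hne, dotProduct_zero]
    exact mul_nonpos_of_nonneg_of_nonpos (by nlinarith) hm0
  · refine le_trans ?_ (mul_le_dotProduct_of_forall_tridiagonal hx.2 hm0
      (fun σ' τ' e he => (hmin (σ', τ')).trans (q_le hF hx he)) hd.2.1 hd.1 hne)
    have hcard : ((Finset.univ.filter fun ji => d ji ≠ 0).card : ℝ) ≤ (n : ℝ) ^ 2 := by
      have := Finset.card_filter_le (Finset.univ : Finset (Fin n × Fin n)) fun ji => d ji ≠ 0
      rw [Finset.card_univ, Fintype.card_prod, Fintype.card_fin, ← sq] at this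
      exact_mod_cast this
    exact mul_le_mul_of_nonpos_right (by linarith) hm0

end Conformal

/-! ### Tridiagonal patterns inside permuted bands -/

section Band

variable {n p : ℕ}

/-- The working set produced by the row permutation `π.1` and the column permutation `π.2`. -/
def bandSupport (n p : ℕ) (π : Equiv.Perm (Fin n) × Equiv.Perm (Fin n)) : Set (Fin n × Fin n) :=
  Function.support (Matrix.vec ((bandMatrix n p).submatrix π.1 π.2))

lemma bandMatrix_add_ne_zero [NeZero n] (b u : Fin n) (hu : (u : ℕ) < p) :
    bandMatrix n p (b + u) b ≠ 0 := by
  have h : ((b : ℕ) ≤ (b + u : Fin n) ∧ ((b + u : Fin n) : ℕ) < b + p) ∨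
      ((b + u : Fin n) : ℕ) + n < b + p := by
    rw [Fin.val_add]
    rcases Nat.lt_or_ge (b + u : ℕ) n with h | h
    · rw [Nat.mod_eq_of_lt h]; omega
    · rw [Nat.mod_eq_sub_mod h, Nat.mod_eq_of_lt (by omega)]; omega
  simp only [bandMatrix, of_apply]
  rw [if_pos h]
  exact one_ne_zero

/-- Composing `σ` and `τ` with cyclic shifts by `s + (t + 1)` and `s` moves the tridiagonal pattern
into the three consecutive diagonals `t, t + 1, t + 2` of the band, for any `t ≤ p - 3`. -/
lemma permutedTridiagonal_subset_bandSupport [NeZero n] (hpn : p ≤ n) (σ τ : Equiv.Perm (Fin n))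
    (s t : Fin n) (ht : (t : ℕ) + 2 < p) :
    permutedTridiagonal σ τ ⊆ bandSupport n p
      (σ.trans (Equiv.addRight (s + (t + 1))), τ.trans (Equiv.addRight s)) := by
  rintro ⟨j, i⟩ ⟨h1, h2⟩
  simp only at h1 h2
  have hσ := (σ i).2
  have hlt : (t : ℕ) + 1 + σ i - τ j < n := by omega
  have hone : ((1 : Fin n) : ℕ) = 1 := by
    rw [Fin.val_one', Nat.mod_eq_of_lt (by omega)]
  have key : σ i + (s + (t + 1)) = (τ j + s) + ⟨(t : ℕ) + 1 + σ i - τ j, hlt⟩ := by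
    have : σ i + (t + 1) = τ j + ⟨(t : ℕ) + 1 + σ i - τ j, hlt⟩ := by
      ext
      rw [Fin.val_add, Fin.val_add, Fin.val_add, hone, Nat.add_mod_mod]
      congr 1
      simp only
      omega
    rw [add_left_comm, this]
    abel
  change bandMatrix n p (σ i + (s + (t + 1))) (τ j + s) ≠ 0
  rw [key]
  exact bandMatrix_add_ne_zero _ _ (by simp only; omega)

/-- Every permuted tridiagonal pattern is contained in at least `n * (p - 2)` permuted bands:
distinct shifts `s` and offsets `t` give distinct pairs of permutations. -/
lemma mul_le_card_filter_subset_bandSupport (hp : 3 ≤ p) (hpn : p ≤ n)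
    (σ τ : Equiv.Perm (Fin n))
    [DecidablePred fun π => permutedTridiagonal σ τ ⊆ bandSupport n p π] :
    n * (p - 2) ≤
      (Finset.univ.filter fun π => permutedTridiagonal σ τ ⊆ bandSupport n p π).card := by
  have : NeZero n := ⟨by omega⟩
  let φ : Fin n × Fin (p - 2) → Equiv.Perm (Fin n) × Equiv.Perm (Fin n) := fun st =>
    (σ.trans (Equiv.addRight (st.1 + (⟨st.2, by omega⟩ + 1))), τ.trans (Equiv.addRight st.1))
  have hφ : Function.Injective φ := by
    rintro ⟨s, t⟩ ⟨s', t'⟩ h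
    obtain ⟨h1, h2⟩ := Prod.ext_iff.1 h
    have hs : s = s' := add_left_cancel (DFunLike.congr_fun h2 (τ.symm 0))
    subst hs
    have ht := add_left_cancel (DFunLike.congr_fun h1 (σ.symm 0))
    have ht' := congrArg Fin.val (add_right_cancel (add_left_cancel ht))
    exact Prod.ext rfl (Fin.ext ht')
  calc n * (p - 2) = (Finset.univ.image φ).card := by
        rw [Finset.card_image_of_injective _ hφ, Finset.card_univ, Fintype.card_prod,
          Fintype.card_fin, Fintype.card_fin]
    _ ≤ _ := Finset.card_le_card fun π hπ => by
        obtain ⟨⟨s, t⟩, -, rfl⟩ := Finset.mem_image.1 hπ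
        exact Finset.mem_filter.2 ⟨Finset.mem_univ _,
          permutedTridiagonal_subset_bandSupport hpn σ τ s _ (by simp only; omega)⟩

/-- The fraction `n (p - 2) / ((n ^ 2 - 3) (n!) ^ 2)` of the best possible decrease that the
diagonal-band working sets are shown to achieve in expectation. -/
noncomputable def bandConstant (n p : ℕ) : ℝ :=
  (n : ℝ) * ((p : ℝ) - 2) / (((n : ℝ) ^ 2 - 3) * (n.factorial : ℝ) ^ 2)

lemma bandConstant_pos (hp : 3 ≤ p) (hpn : p ≤ n) : 0 < bandConstant n p := by
  have hp' : (3 : ℝ) ≤ p := by exact_mod_cast hp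
  have hn' : (p : ℝ) ≤ n := by exact_mod_cast hpn
  have hf : (0 : ℝ) < n.factorial := by exact_mod_cast n.factorial_pos
  exact div_pos (by nlinarith) (mul_pos (by nlinarith) (by positivity))

lemma bandConstant_le_one (hp : 3 ≤ p) (hpn : p ≤ n) : bandConstant n p ≤ 1 := by
  have hp' : (3 : ℝ) ≤ p := by exact_mod_cast hp
  have hn' : (p : ℝ) ≤ n := by exact_mod_cast hpn
  have hf : (1 : ℝ) ≤ n.factorial := by exact_mod_cast n.factorial_pos
  have h3 : 0 < (n : ℝ) ^ 2 - 3 := by nlinarith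
  refine div_le_one_of_le₀ ?_ (by positivity)
  calc (n : ℝ) * (p - 2) ≤ (n : ℝ) ^ 2 - 3 := by nlinarith
    _ ≤ ((n : ℝ) ^ 2 - 3) * (n.factorial : ℝ) ^ 2 :=
        le_mul_of_one_le_right h3.le (one_le_pow₀ hf)

/-- Averaged over all permutations, the band working sets achieve the fraction `bandConstant n p`
of the best possible decrease. -/
lemma average_q_bandSupport_le {b : Fin n ⊕ Fin n → ℝ} (hp : 3 ≤ p) (hpn : p ≤ n)
    (hF : IsCompact (feasibleSet (otMatrix n) b)) (c : Fin n × Fin n → ℝ)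
    {x : Fin n × Fin n → ℝ} (hx : x ∈ feasibleSet (otMatrix n) b) :
    ((n.factorial : ℝ) ^ 2)⁻¹ * ∑ π, q (otMatrix n) c x (bandSupport n p π)
      ≤ bandConstant n p * q (otMatrix n) c x Set.univ := by
  classical
  obtain ⟨σ, τ, h⟩ := exists_permutedTridiagonal_q_le (by omega) hF c hx
  set m := q (otMatrix n) c x (permutedTridiagonal σ τ)
  have hm0 : m ≤ 0 := q_nonpos hF hx
  have hp' : (3 : ℝ) ≤ p := by exact_mod_cast hp
  have hn' : (p : ℝ) ≤ n := by exact_mod_cast hpn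
  have hf : (0 : ℝ) < n.factorial := by exact_mod_cast n.factorial_pos
  have h3 : 0 < (n : ℝ) ^ 2 - 3 := by nlinarith
  have hsum : ∑ π, q (otMatrix n) c x (bandSupport n p π) ≤ (n : ℝ) * (p - 2) * m := by
    set T := Finset.univ.filter fun π => permutedTridiagonal σ τ ⊆ bandSupport n p π with hT
    have hcard : (n : ℝ) * (p - 2) ≤ T.card := by
      have := mul_le_card_filter_subset_bandSupport hp hpn σ τ
      rw [← hT] at this
      have h2 : ((n * (p - 2) : ℕ) : ℝ) ≤ T.card := by exact_mod_cast this
      rwa [Nat.cast_mul, Nat.cast_sub (by omega), Nat.cast_ofNat] at h2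
    calc ∑ π, q (otMatrix n) c x (bandSupport n p π)
        ≤ ∑ π ∈ T, q (otMatrix n) c x (bandSupport n p π) := by
          rw [← Finset.sum_add_sum_compl T]
          exact add_le_of_nonpos_right (Finset.sum_nonpos fun π _ => q_nonpos hF hx)
      _ ≤ ∑ _π ∈ T, m :=
          Finset.sum_le_sum fun π hπ => q_anti hF hx (Finset.mem_filter.1 hπ).2
      _ = T.card * m := by rw [Finset.sum_const, nsmul_eq_mul]
      _ ≤ (n : ℝ) * (p - 2) * m := mul_le_mul_of_nonpos_right hcard hm0
  calc ((n.factorial : ℝ) ^ 2)⁻¹ * ∑ π, q (otMatrix n) c x (bandSupport n p π)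
      ≤ ((n.factorial : ℝ) ^ 2)⁻¹ * ((n : ℝ) * (p - 2) * m) :=
        mul_le_mul_of_nonneg_left hsum (by positivity)
    _ = bandConstant n p * (((n : ℝ) ^ 2 - 3) * m) := by
        rw [bandConstant]; field_simp
    _ ≤ _ := mul_le_mul_of_nonneg_left h (bandConstant_pos hp hpn).le

end Band

/-! ### The transport polytope is compact -/

lemma isCompact_feasibleSet_otMatrix {n : ℕ} (r₁ r₂ : Fin n → ℝ) :
    IsCompact (feasibleSet (otMatrix n) (Sum.elim r₁ r₂)) := by
  refine (isCompact_Icc (a := (0 : Fin n × Fin n → ℝ)) (b := fun ji => r₁ ji.2)).of_isClosed_subset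
    (isClosed_feasibleSet _ _) fun x hx => ⟨hx.2, fun ji => ?_⟩
  have h := congrFun hx.1 (Sum.inl ji.2)
  rw [otMatrix_mulVec_inl, Sum.elim_inl] at h
  exact (Finset.single_le_sum (f := fun j => x (j, ji.2)) (fun j _ => hx.2 (j, ji.2))
    (Finset.mem_univ ji.1)).trans_eq h

/-! ### Conditional expectation given an independent finite choice -/

section CondExp

variable {Ω β : Type*} {m m₀ : MeasurableSpace Ω} {μ : Measure Ω} [IsProbabilityMeasure μ]
  [Fintype β] [MeasurableSpace β] [MeasurableSingletonClass β]
  {J : Ω → β} {g : β → Ω → ℝ}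

/-- If `J` is independent of `m` and every `g s` is `m`-measurable, then conditioning
`ω ↦ g (J ω) ω` on `m` averages over the law of `J` with `ω` frozen. -/
lemma condExp_apply_of_indep (hm : m ≤ m₀) (hJ : Measurable J)
    (hind : Indep (MeasurableSpace.comap J inferInstance) m μ)
    (hg : ∀ s, StronglyMeasurable[m] (g s)) (hgi : ∀ s, Integrable (g s) μ) :
    μ[fun ω => g (J ω) ω | m] =ᵐ[μ] fun ω => ∫ s, g s ω ∂(μ.map J) := by
  classical
  have := Measure.isProbabilityMeasure_map (μ := μ) hJ.aemeasurable
  have hset : ∀ s, MeasurableSet (J ⁻¹' {s}) := fun s => hJ (measurableSet_singleton s)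
  have hdecomp : (fun ω => g (J ω) ω) =
      ∑ s, (J ⁻¹' {s}).indicator (fun _ => (1 : ℝ)) * g s := by
    ext ω
    simp [Finset.sum_apply, Set.indicator_apply]
  have hint : ∀ s, Integrable ((J ⁻¹' {s}).indicator (fun _ => (1 : ℝ)) * g s) μ := fun s => by
    have : (J ⁻¹' {s}).indicator (fun _ => (1 : ℝ)) * g s = (J ⁻¹' {s}).indicator (g s) := by
      ext ω
      simp [Set.indicator_apply]
    rw [this]
    exact (hgi s).indicator (hset s)
  have hterm : ∀ s, μ[(J ⁻¹' {s}).indicator (fun _ => (1 : ℝ)) * g s | m] =ᵐ[μ]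
      fun ω => (μ.map J).real {s} * g s ω := fun s => by
    have h1 := condExp_mul_of_stronglyMeasurable_right (hg s) (hint s)
      ((integrable_const (1 : ℝ)).indicator (hset s))
    have h2 := condExp_indep_eq (f := (J ⁻¹' {s}).indicator fun _ => (1 : ℝ)) hJ.comap_le hm
      (stronglyMeasurable_const.indicator ⟨{s}, measurableSet_singleton s, rfl⟩) hind
    filter_upwards [h1, h2] with ω h1 h2
    rw [h1, Pi.mul_apply, h2, integral_indicator_const _ (hset s), smul_eq_mul, mul_one,
      map_measureReal_apply hJ (measurableSet_singleton s)]
  rw [hdecomp]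
  refine (condExp_finsetSum (fun s _ => hint s) m).trans ?_
  have hall := ae_all_iff.2 hterm
  filter_upwards [hall] with ω hω
  rw [Finset.sum_apply, integral_fintype Integrable.of_finite]
  exact Finset.sum_congr rfl fun s _ => by rw [hω s, smul_eq_mul]

end CondExp

lemma integral_diagonalBandLaw {n p : ℕ} (g : Set (Fin n × Fin n) → ℝ) :
    ∫ s, g s ∂(diagonalBandLaw n p).toMeasure =
      ((n.factorial : ℝ) ^ 2)⁻¹ * ∑ π, g (bandSupport n p π) := by
  let : MeasurableSpace (Equiv.Perm (Fin n) × Equiv.Perm (Fin n)) := ⊤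
  have hlaw : (diagonalBandLaw n p).toMeasure =
      (PMF.uniformOfFintype (Equiv.Perm (Fin n) × Equiv.Perm (Fin n))).toMeasure.map
        (bandSupport n p) := (PMF.toMeasure_map _ _ (measurable_from_top)).symm
  rw [hlaw, integral_map measurable_from_top.aemeasurable
    (Measurable.of_discrete).aestronglyMeasurable, PMF.integral_eq_sum, Finset.mul_sum]
  refine Finset.sum_congr rfl fun π _ => ?_
  simp [PMF.uniformOfFintype_apply, Fintype.card_perm, sq]

/-! ### The random block coordinate descent process -/

section Iterates

variable {Ω : Type*} [MeasurableSpace Ω] {μ : Measure Ω} {n p : ℕ}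
  {C : Matrix (Fin n) (Fin n) ℝ} {r₁ r₂ : Fin n → ℝ}
  {x : ℕ → Ω → Fin n × Fin n → ℝ} {I : ℕ → Ω → Set (Fin n × Fin n)}

namespace IsDiagonalBandRBCD

variable (h : IsDiagonalBandRBCD μ n p C r₁ r₂ x I)

include h

lemma mem_feasibleSet (k : ℕ) (ω : Ω) :
    x k ω ∈ feasibleSet (otMatrix n) (Sum.elim r₁ r₂) := by
  induction k with
  | zero => exact h.init ω
  | succ k ih =>
    obtain ⟨d, hd, hstep⟩ := h.step k ω
    rw [hstep]
    exact add_mem_feasibleSet ih hd.1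

lemma history_le (k : ℕ) : history x k ≤ ‹MeasurableSpace Ω› :=
  iSup₂_le fun j _ => (h.measurable_iterate j).comap_le

/-- The realized decrease equals `q`, since the step is a minimizing direction. -/
lemma q_eq (k : ℕ) (ω : Ω) : q (otMatrix n) (Matrix.vec C) (x k ω) (I k ω) =
    Matrix.vec C ⬝ᵥ x (k + 1) ω - Matrix.vec C ⬝ᵥ x k ω := by
  obtain ⟨d, hd, hstep⟩ := h.step k ω
  rw [hstep, dotProduct_add, add_sub_cancel_left]
  exact q_eq_of_mem_argminDirections (isCompact_feasibleSet_otMatrix r₁ r₂)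
    (h.mem_feasibleSet k ω) hd

lemma integrable_objective [IsProbabilityMeasure μ] (k : ℕ) :
    Integrable (fun ω => Matrix.vec C ⬝ᵥ x k ω) μ := by
  obtain ⟨M, hM⟩ := exists_abs_dotProduct_le (isCompact_feasibleSet_otMatrix r₁ r₂) (Matrix.vec C)
  exact Integrable.of_bound ((continuous_dotProduct_left _).measurable.comp
    (h.measurable_iterate k)).aestronglyMeasurable M
    (Eventually.of_forall fun ω => hM _ (h.mem_feasibleSet k ω))

lemma integrable_q [IsProbabilityMeasure μ] (k : ℕ) :
    Integrable (fun ω => q (otMatrix n) (Matrix.vec C) (x k ω) (I k ω)) μ := by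
  simp only [h.q_eq k]
  exact (h.integrable_objective (k + 1)).sub (h.integrable_objective k)

lemma measurable_history_q (k : ℕ) (s : Set (Fin n × Fin n)) :
    Measurable[history x k] fun ω => q (otMatrix n) (Matrix.vec C) (x k ω) s := by
  have hx : Measurable[history x k] (x k) :=
    (comap_measurable (x k)).mono (le_iSup₂_of_le k le_rfl le_rfl) le_rfl
  exact measurable_q_comp (isCompact_feasibleSet_otMatrix r₁ r₂) (Matrix.vec C) hx
    (h.mem_feasibleSet k) s

theorem expectedGaussSouthwellQ [IsProbabilityMeasure μ] (hp : 3 ≤ p) (hpn : p ≤ n) :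
    ExpectedGaussSouthwellQ μ (otMatrix n) (Matrix.vec C) x I (bandConstant n p) := by
  refine ⟨bandConstant_pos hp hpn, bandConstant_le_one hp hpn, fun k => ⟨h.integrable_q k, ?_⟩⟩
  have hF := isCompact_feasibleSet_otMatrix r₁ r₂
  obtain ⟨M, hM⟩ := exists_abs_q_le hF (Matrix.vec C)
  have hcond := condExp_apply_of_indep
    (g := fun s ω => q (otMatrix n) (Matrix.vec C) (x k ω) s) (h.history_le k)
    (h.measurable_workingSet k) (h.indep k)
    (fun s => (h.measurable_history_q k s).stronglyMeasurable)
    (fun s => Integrable.of_bound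
      ((h.measurable_history_q k s).mono (h.history_le k) le_rfl).aestronglyMeasurable M
      (Eventually.of_forall fun ω => hM _ (h.mem_feasibleSet k ω) s))
  filter_upwards [hcond] with ω hω
  rw [hω, h.law k, integral_diagonalBandLaw]
  exact average_q_bandSupport_le hp hpn hF _ (h.mem_feasibleSet k ω)

variable {xstar : Fin n × Fin n → ℝ}
  (hstar : xstar ∈ optimalSet (otMatrix n) (Sum.elim r₁ r₂) (Matrix.vec C))

lemma integrable_gap [IsProbabilityMeasure μ] (y : Fin n × Fin n → ℝ) (k : ℕ) :
    Integrable (fun ω => Matrix.vec C ⬝ᵥ (x k ω - y)) μ := by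
  simp only [dotProduct_sub]
  exact (h.integrable_objective k).sub (integrable_const _)

lemma antitone_gap (y : Fin n × Fin n → ℝ) (ω : Ω) :
    Antitone fun k => Matrix.vec C ⬝ᵥ (x k ω - y) := by
  refine antitone_nat_of_succ_le fun k => ?_
  have h1 := q_nonpos (c := Matrix.vec C) (I := I k ω) (isCompact_feasibleSet_otMatrix r₁ r₂)
    (h.mem_feasibleSet k ω)
  rw [h.q_eq k ω] at h1
  simp only [dotProduct_sub]
  linarith

include hstar

lemma gap_nonneg (k : ℕ) (ω : Ω) : 0 ≤ Matrix.vec C ⬝ᵥ (x k ω - xstar) := by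
  rw [dotProduct_sub, sub_nonneg]
  exact hstar.2 _ (h.mem_feasibleSet k ω)

lemma integral_gap_succ_le [IsProbabilityMeasure μ] {v : ℝ}
    (hv : ExpectedGaussSouthwellQ μ (otMatrix n) (Matrix.vec C) x I v) (k : ℕ) :
    ∫ ω, Matrix.vec C ⬝ᵥ (x (k + 1) ω - xstar) ∂μ ≤
      (1 - v) * ∫ ω, Matrix.vec C ⬝ᵥ (x k ω - xstar) ∂μ := by
  obtain ⟨hv0, -, hrule⟩ := hv
  have hgap := h.integrable_gap xstar k
  -- the full direction `xstar - x k` bounds `q(x k; all)`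
  have hq : ∀ ω, v * q (otMatrix n) (Matrix.vec C) (x k ω) Set.univ ≤
      -v * (Matrix.vec C ⬝ᵥ (x k ω - xstar)) := fun ω => by
    have := q_le (c := Matrix.vec C) (isCompact_feasibleSet_otMatrix r₁ r₂)
      (h.mem_feasibleSet k ω) (sub_mem_directions_univ (h.mem_feasibleSet k ω) hstar.1)
    rw [← neg_sub, dotProduct_neg] at this
    nlinarith
  have hdec : ∫ ω, q (otMatrix n) (Matrix.vec C) (x k ω) (I k ω) ∂μ ≤
      -v * ∫ ω, Matrix.vec C ⬝ᵥ (x k ω - xstar) ∂μ := by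
    rw [← integral_condExp (h.history_le k), ← integral_const_mul]
    refine integral_mono_ae integrable_condExp (hgap.const_mul _) ?_
    filter_upwards [(hrule k).2] with ω hω
    exact hω.trans (hq ω)
  have hsplit : ∫ ω, Matrix.vec C ⬝ᵥ (x (k + 1) ω - xstar) ∂μ =
      ∫ ω, Matrix.vec C ⬝ᵥ (x k ω - xstar) ∂μ +
        ∫ ω, q (otMatrix n) (Matrix.vec C) (x k ω) (I k ω) ∂μ := by
    rw [← integral_add hgap (h.integrable_q k)]
    refine integral_congr_ae (Eventually.of_forall fun ω => ?_)
    simp only [h.q_eq k ω, dotProduct_sub]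
    ring
  rw [hsplit]
  linarith

lemma integral_gap_le [IsProbabilityMeasure μ] {v : ℝ}
    (hv : ExpectedGaussSouthwellQ μ (otMatrix n) (Matrix.vec C) x I v) (k : ℕ) :
    ∫ ω, Matrix.vec C ⬝ᵥ (x k ω - xstar) ∂μ ≤
      (1 - v) ^ k * ∫ ω, Matrix.vec C ⬝ᵥ (x 0 ω - xstar) ∂μ := by
  induction k with
  | zero => simp
  | succ k ih =>
    calc _ ≤ (1 - v) * ∫ ω, Matrix.vec C ⬝ᵥ (x k ω - xstar) ∂μ :=
          h.integral_gap_succ_le hstar hv k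
      _ ≤ (1 - v) * ((1 - v) ^ k * ∫ ω, Matrix.vec C ⬝ᵥ (x 0 ω - xstar) ∂μ) :=
          mul_le_mul_of_nonneg_left ih (by linarith [hv.2.1])
      _ = _ := by ring

/-- The gaps decrease pointwise to a nonnegative limit whose expectation is below every term of a
geometric sequence, hence zero. -/
lemma ae_tendsto_gap [IsProbabilityMeasure μ] {v : ℝ}
    (hv : ExpectedGaussSouthwellQ μ (otMatrix n) (Matrix.vec C) x I v) :
    ∀ᵐ ω ∂μ, Tendsto (fun k => Matrix.vec C ⬝ᵥ (x k ω - xstar)) atTop (𝓝 0) := by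
  set Y : ℕ → Ω → ℝ := fun k ω => Matrix.vec C ⬝ᵥ (x k ω - xstar) with hY
  have hbdd : ∀ ω, BddBelow (Set.range fun k => Y k ω) := fun ω =>
    ⟨0, by rintro _ ⟨k, rfl⟩; exact h.gap_nonneg hstar k ω⟩
  have hlim : ∀ ω, Tendsto (fun k => Y k ω) atTop (𝓝 (⨅ k, Y k ω)) := fun ω =>
    tendsto_atTop_ciInf (h.antitone_gap xstar ω) (hbdd ω)
  set L : Ω → ℝ := fun ω => ⨅ k, Y k ω with hL
  have hL0 : 0 ≤ L := fun ω => le_ciInf fun k => h.gap_nonneg hstar k ω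
  have hLmeas : AEStronglyMeasurable L μ := aestronglyMeasurable_of_tendsto_ae atTop
    (fun k => (h.integrable_gap xstar k).aestronglyMeasurable) (Eventually.of_forall hlim)
  have hLint : Integrable L μ := (h.integrable_gap xstar 0).mono hLmeas
    (Eventually.of_forall fun ω => by
      rw [Real.norm_of_nonneg (hL0 ω), Real.norm_of_nonneg (h.gap_nonneg hstar 0 ω)]
      exact ciInf_le (hbdd ω) 0)
  have hle : ∀ k, ∫ ω, L ω ∂μ ≤ (1 - v) ^ k * ∫ ω, Y 0 ω ∂μ := fun k =>
    (integral_mono hLint (h.integrable_gap xstar k) fun ω => ciInf_le (hbdd ω) k).trans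
      (h.integral_gap_le hstar hv k)
  have hgeom : Tendsto (fun k : ℕ => (1 - v) ^ k * ∫ ω, Y 0 ω ∂μ) atTop (𝓝 0) := by
    simpa using (tendsto_pow_atTop_nhds_zero_of_lt_one (by linarith [hv.2.1])
      (by linarith [hv.1])).mul_const (∫ ω, Y 0 ω ∂μ)
  have hzero : ∫ ω, L ω ∂μ = 0 :=
    le_antisymm (ge_of_tendsto' hgeom hle) (integral_nonneg hL0)
  filter_upwards [(integral_eq_zero_iff_of_nonneg hL0 hLint).1 hzero] with ω hω
  have := hlim ω
  rwa [show (⨅ k, Y k ω) = 0 from hω] at this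

end IsDiagonalBandRBCD

end Iterates

end RBCD

theorem mainTheorem5 {Ω : Type*} [MeasurableSpace Ω] (μ : Measure Ω) [IsProbabilityMeasure μ]
    (n p : ℕ) (hp : 3 ≤ p) (hpn : p ≤ n)
    (C : Matrix (Fin n) (Fin n) ℝ) (r₁ r₂ : Fin n → ℝ)
    (x : ℕ → Ω → Fin n × Fin n → ℝ) (I : ℕ → Ω → Set (Fin n × Fin n))
    (hrun : RBCD.IsDiagonalBandRBCD μ n p C r₁ r₂ x I) :
    RBCD.ExpectedGaussSouthwellQ μ (RBCD.otMatrix n) (Matrix.vec C) x I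
      ((n : ℝ) * ((p : ℝ) - 2) / (((n : ℝ) ^ 2 - 3) * (n.factorial : ℝ) ^ 2)) ∧
    ∀ xstar ∈ RBCD.optimalSet (RBCD.otMatrix n) (Sum.elim r₁ r₂) (Matrix.vec C),
      (∀ᵐ ω ∂μ, Tendsto (fun k => Matrix.vec C ⬝ᵥ (x k ω - xstar)) atTop (𝓝 0)) ∧
      (∀ k, Integrable (fun ω => Matrix.vec C ⬝ᵥ (x k ω - xstar)) μ ∧
        0 ≤ ∫ ω, Matrix.vec C ⬝ᵥ (x k ω - xstar) ∂μ) ∧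
      ∀ v : ℝ, RBCD.ExpectedGaussSouthwellQ μ (RBCD.otMatrix n) (Matrix.vec C) x I v →
        ∀ k, ∫ ω, Matrix.vec C ⬝ᵥ (x k ω - xstar) ∂μ
          ≤ (1 - v) ^ k * ∫ ω, Matrix.vec C ⬝ᵥ (x 0 ω - xstar) ∂μ := by
  have hrule := hrun.expectedGaussSouthwellQ hp hpn
  exact ⟨hrule, fun xstar hstar => ⟨hrun.ae_tendsto_gap hstar hrule,
    fun k => ⟨hrun.integrable_gap xstar k, integral_nonneg (hrun.gap_nonneg hstar k)⟩,
    fun v hv => hrun.integral_gap_le hstar hv⟩⟩
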